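/- Let $R>0$ and $n\in\mathbb{N}$, let $h:[-R,R]^n\to\mathbb{R}$ be continuous, and let $\mu$ be a Borel probability measure on $[-R,R]^n$ with marginals $\mu_1,\dots,\mu_n$ on $[-R,R]$. We use the following notions. The Gibbs measure of a continuous function $f$ on $[-R,R]^m$ is the probability measure $Z_f^{-1}e^{f(\mathbf{x})}\,d\mathbf{x}$ with $Z_f=\int_{[-R,R]^m}e^{f(\mathbf{x})}\,d\mathbf{x}$. The marginal potentials of $h$ are the functions $$h_i(x)=\log\int_{[-R,R]^{n-1}}e^{h(x_1,\dots,x_{i-1},x,x_{i+1},\dots,x_n)}\,dx_1\cdots dx_{i-1}\,dx_{i+1}\cdots dx_n,\qquad x\in[-R,R],\ 1\le i\le n.$$ An approximating sequence for $(\mu_1,\dots,\mu_n)$ is a sequence $\Xi(N)=(\xi_1(N),\dots,\xi_n(N))$, $N\in\mathbb{N}$, of $n$-tuples of vectors $\xi_i(N)=(\xi_{i1}(N),\dots,\xi_{iN}(N))\in[-R,R]^N$ with $\xi_{i1}(N)\le\dots\le\xi_{iN}(N)$ such that $\frac1N\sum_{j=1}^N\xi_{ij}(N)^k\to\int x^k\,d\mu_i(x)$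 as $N\to\infty$ for all $k\in\mathbb{N}$ and $1\le i\le n$. Such sequences exist; let $\Xi$ be any one of them. For continuous $f:[-R,R]^n\to\mathbb{R}$ the mutual pressure of $f$ with respect to $(\mu_1,\dots,\mu_n)$ is $$P_{\mathrm{sym}}(f:\mu_1,\dots,\mu_n)=\limsup_{N\to\infty}\frac1N\log\Biggl[\frac1{(N!)^n}\sum_{\sigma_1,\dots,\sigma_n\in S_N}\exp\Biggl(\sum_{j=1}^N f\bigl(\xi_{1\sigma_1^{-1}(j)}(N),\dots,\xi_{n\sigma_n^{-1}(j)}(N)\bigr)\Biggr)\Biggr].$$ Let $$\mathcal{I}_{\mathrm{sym}}(\mu)=\sup\Bigl\{\int f\,d\mu-P_{\mathrm{sym}}(f:\mu_1,\dots,\mu_n)\ :\ f\in C_{\mathbb{R}}([-R,R]^n)\Bigr\}\in(-\infty,+\infty].$$ The measure $\mu$ is called mutually equilibrium associated with $h$ if $\mathcal{I}_{\mathrm{sym}}(\mu)=\int h\,d\mu-P_{\mathrm{sym}}(h:\mu_1,\dots,\mu_n)$. Then, for every choice of the approximating sequence $\Xi$, the following are equivalent: (i) $\mu$ is the Gibbs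 measure of $h$; (ii) $\mu$ is mutually equilibrium associated with $h$, and $\mu_i$ is the Gibbs measure of $h_i$ for each $i=1,\dots,n$. -/

import Mathlib

open MeasureTheory Filter Topology

noncomputable section

namespace MutualPressure

/-- The interval `[-R, R]`. -/
abbrev Seg (R : ℝ) : Type := Set.Icc (-R) R

/-- The `volume` of `[-R, R]` is Lebesgue measure on the interval. -/
instance instMeasureSpaceSeg (R : ℝ) : MeasureSpace (Seg R) := Measure.Subtype.measureSpace

/-- The cube `[-R, R]^n`. Its `volume`, the product measure, is `n`-dimensional Lebesgue measure
on the cube. -/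
abbrev Cube (R : ℝ) (n : ℕ) : Type := Fin n → Seg R

/-- The Gibbs measure `Z⁻¹ e^{f(x)} dx`, `Z = ∫ e^{f(x)} dx`, of a potential `f`
(used for `X = [-R, R]^n` and for `X = [-R, R]`). -/
def gibbsMeasure {X : Type*} [MeasureSpace X] (f : X → ℝ) : Measure X :=
  (volume : Measure X).withDensity
    fun x => ENNReal.ofReal (Real.exp (f x) / ∫ y, Real.exp (f y))

/-- The `i`-th marginal of a measure on the cube. -/
def marginal {R : ℝ} {n : ℕ} (μ : Measure (Cube R n)) (i : Fin n) : Measure (Seg R) :=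
  μ.map fun x => x i

/-- The point of the cube with `i`-th coordinate `x` and the other coordinates given by `y`. -/
def insertCoord {R : ℝ} {n : ℕ} (i : Fin n) (x : Seg R) (y : {j : Fin n // j ≠ i} → Seg R) :
    Cube R n :=
  fun j => if hj : j = i then x else y ⟨j, hj⟩

/-- The marginal potential
`h_i(x) = log ∫ e^{h(x_1, …, x_{i-1}, x, x_{i+1}, …, x_n)} dx_1 ⋯ dx_{i-1} dx_{i+1} ⋯ dx_n`,
the integral being over `[-R, R]^{n-1}`, with coordinates indexed by the `j ≠ i`. -/
def marginalPotential {R : ℝ} {n : ℕ} (h : C(Cube R n, ℝ)) (i : Fin n) (x : Seg R) : ℝ :=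
  Real.log (∫ y : {j : Fin n // j ≠ i} → Seg R, Real.exp (h (insertCoord i x y)))

/-- The mean value `κ_N(x) = (x_1 + ⋯ + x_N) / N`. -/
def mean {N : ℕ} (x : Fin N → ℝ) : ℝ := (N : ℝ)⁻¹ * ∑ j, x j

/-- `Ξ` is an approximating sequence for `(ν_1, …, ν_n)`: each `Ξ N i` is a vector in
`[-R, R]^N` with increasing coordinates, and `Ξ N i → ν_i` in moments as `N → ∞`. -/
structure IsApproximating {R : ℝ} {n : ℕ} (Ξ : (N : ℕ) → Fin n → Fin N → Seg R)
    (ν : Fin n → Measure (Seg R)) : Prop where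
  monotone : ∀ N i, Monotone (Ξ N i)
  tendsto_moment : ∀ (i : Fin n) (k : ℕ),
    Tendsto (fun N => mean fun j => (Ξ N i j : ℝ) ^ k) atTop (𝓝 (∫ x, (x : ℝ) ^ k ∂ν i))

/-- Every tuple of probability measures on `[-R, R]` has an approximating sequence
(sorted samples of independent variables). -/
theorem exists_isApproximating {R : ℝ} {n : ℕ} (ν : Fin n → Measure (Seg R))
    [∀ i, IsProbabilityMeasure (ν i)] :
    ∃ Ξ : (N : ℕ) → Fin n → Fin N → Seg R, IsApproximating Ξ ν := by
  have key : ∀ i, ∃ ω : ℕ → Seg R, ∀ k : ℕ,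
      Tendsto (fun N : ℕ => (∑ j ∈ Finset.range N, (ω j : ℝ) ^ k) / (N : ℝ)) atTop
        (𝓝 (∫ x, (x : ℝ) ^ k ∂ν i)) := by
    intro i
    let P : Measure (ℕ → Seg R) := Measure.infinitePi fun _ => ν i
    have hm : ∀ k : ℕ, Measurable fun x : Seg R => (x : ℝ) ^ k := fun k => by fun_prop
    have hmp : ∀ j : ℕ, MeasurePreserving (fun ω : ℕ → Seg R => ω j) P (ν i) := fun j =>
      measurePreserving_eval_infinitePi (fun _ => ν i) j
    have hae : ∀ᵐ ω ∂P, ∀ k : ℕ,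
        Tendsto (fun N : ℕ => (∑ j ∈ Finset.range N, (ω j : ℝ) ^ k) / (N : ℝ)) atTop
          (𝓝 (∫ x, (x : ℝ) ^ k ∂ν i)) := by
      rw [ae_all_iff]
      intro k
      have hint : Integrable (fun x : Seg R => (x : ℝ) ^ k) (ν i) :=
        Continuous.integrable_of_hasCompactSupport (by fun_prop) (HasCompactSupport.of_compactSpace _)
      have hI : ProbabilityTheory.iIndepFun (fun (j : ℕ) (ω : ℕ → Seg R) => (ω j : ℝ) ^ k) P :=
        ProbabilityTheory.iIndepFun_infinitePi (P := fun _ => ν i)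
          (X := fun _ x => (x : ℝ) ^ k) (fun _ => hm k)
      have := ProbabilityTheory.strong_law_ae_real
        (fun (j : ℕ) (ω : ℕ → Seg R) => (ω j : ℝ) ^ k) (μ := P)
        ((hmp 0).integrable_comp_of_integrable hint)
        (fun a b hab => hI.indepFun hab)
        (fun j =>
          { aemeasurable_fst := ((hm k).comp (measurable_pi_apply j)).aemeasurable
            aemeasurable_snd := ((hm k).comp (measurable_pi_apply 0)).aemeasurable
            map_eq := by
              have h1 := Measure.map_map (μ := P) (hm k) (measurable_pi_apply j)
              have h2 := Measure.map_map (μ := P) (hm k) (measurable_pi_apply 0)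
              rw [(hmp j).map_eq] at h1
              rw [(hmp 0).map_eq] at h2
              exact h1.symm.trans h2 })
      have he : (∫ ω, (ω 0 : ℝ) ^ k ∂P) = ∫ x, (x : ℝ) ^ k ∂ν i := by
        rw [← (hmp 0).map_eq, integral_map (measurable_pi_apply 0).aemeasurable
          (hm k).aestronglyMeasurable]
      rw [← he]
      exact this
    exact hae.exists
  choose ω hω using key
  refine ⟨fun N i => (fun j : Fin N => ω i j) ∘ Tuple.sort (fun j : Fin N => ω i j),
    fun N i => Tuple.monotone_sort _, fun i k => (hω i k).congr fun N => ?_⟩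
  rw [mean, div_eq_inv_mul, Finset.sum_range fun j => (ω i j : ℝ) ^ k]
  congr 1
  exact (Equiv.sum_comp (Tuple.sort fun j : Fin N => ω i j)
    (fun j : Fin N => (ω i j : ℝ) ^ k)).symm

/-- The `N`-th term in the definition of the mutual pressure:
`(1/N) log [(N!)^{-n} ∑_{σ_1, …, σ_n ∈ S_N} exp (N κ_N(h(σ_1(ξ_1), …, σ_n(ξ_n))))]`,
where `σ(x)_j = x_{σ⁻¹(j)}`. -/
def mutualPressureTerm {R : ℝ} {n N : ℕ} (ξ : Fin n → Fin N → Seg R) (h : C(Cube R n, ℝ)) : ℝ :=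
  (N : ℝ)⁻¹ * Real.log (((N.factorial : ℝ) ^ n)⁻¹ *
    ∑ σ : Fin n → Equiv.Perm (Fin N),
      Real.exp (N * mean fun j => h fun i => ξ i ((σ i)⁻¹ j)))

/-- The mutual pressure of `h`, computed along the sequence `Ξ`. The terms lie in
`[-‖h‖, ‖h‖]`, so that the `limsup` of reals is the usual one. When `Ξ` is an approximating
sequence for `(ν_1, …, ν_n)` this is the mutual pressure `P_sym(h : ν_1, …, ν_n)`. -/
def mutualPressure {R : ℝ} {n : ℕ} (Ξ : (N : ℕ) → Fin n → Fin N → Seg R)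
    (h : C(Cube R n, ℝ)) : ℝ :=
  limsup (fun N => mutualPressureTerm (Ξ N) h) atTop

/-- The Legendre transform `sup {μ(f) - P_sym(f) : f ∈ C([-R, R]^n)} ∈ (-∞, ∞]` of the mutual
pressure, for `Ξ` an approximating sequence of the marginals of `μ`. -/
def mutualInfo {R : ℝ} {n : ℕ} (Ξ : (N : ℕ) → Fin n → Fin N → Seg R)
    (μ : Measure (Cube R n)) : EReal :=
  ⨆ f : C(Cube R n, ℝ), (((∫ x, f x ∂μ) - mutualPressure Ξ f : ℝ) : EReal)

/-- `μ` is mutually equilibrium associated with `h`: the supremum defining the Legendre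
transform is finite and attained at `h`. Here `Ξ` is an approximating sequence of the
marginals of `μ`. -/
def IsMutuallyEquilibrium {R : ℝ} {n : ℕ} (Ξ : (N : ℕ) → Fin n → Fin N → Seg R)
    (μ : Measure (Cube R n)) (h : C(Cube R n, ℝ)) : Prop :=
  mutualInfo Ξ μ = (((∫ x, h x ∂μ) - mutualPressure Ξ h : ℝ) : EReal)

end MutualPressure

end

noncomputable section

namespace MutualPressure

/-! Let `G` be the Gibbs measure of `h` and `ν` the tuple of its marginals, which by Fubini are the
Gibbs measures of the `h_i`. Then `G = e^g · ⊗ν`, where `g` is `h` minus a sum of one-coordinate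
functions. Along an approximating sequence of `ν`, the pressure `P` obeys `∫ (f - g) dG ≤ P(f) ≤ log
∫ e^f d(⊗ν)`, and adding a one-coordinate sum to `f` shifts `P(f)` by the integral of that sum. In
particular `P(g) = 0`. The lower bound gives `∫ f dG - P(f) ≤ ∫ g dG = ∫ h dG - P(h)`, so `G` is in
equilibrium. Conversely, comparing `h` with `h + t u` gives `t ∫ u dμ ≤ P(g + t u) - P(g) ≤ log ∫
e^{tu} dG` for all real `t`, and the derivative at `t = 0` yields `∫ u dμ = ∫ u dG`. For the two
bounds, draw an i.i.d. sample from `⊗ν`. Its law is invariant under independent permutations of the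
coordinates, so `exp ∑ f` can be replaced by its permutation average
(`setIntegral_exp_sum_eq_permAverage`). On samples with nearly the statistics of `ξ` this average is
that of `ξ` up to `e^{δN}` (`exists_permAverage_comparison`), and such samples have probability at
least `1/2`, under `⊗ν` for the upper bound and under `G` for the lower one. -/

/-- The average of `exp (∑ j, f (ξ_{1 σ_1⁻¹(j)}, …, ξ_{n σ_n⁻¹(j)}))` over tuples of
permutations. -/
def permAverage {R : ℝ} {n N : ℕ} (ξ : Fin n → Fin N → Seg R) (f : C(Cube R n, ℝ)) : ℝ :=
  ((N.factorial : ℝ) ^ n)⁻¹ *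
    ∑ σ : Fin n → Equiv.Perm (Fin N), Real.exp (∑ j, f fun i => ξ i ((σ i)⁻¹ j))

/-! ### Permutation averages -/

lemma natCast_mul_mean {N : ℕ} (x : Fin N → ℝ) : (N : ℝ) * mean x = ∑ j, x j := by
  rcases Nat.eq_zero_or_pos N with rfl | hN
  · simp [mean]
  · have : (N : ℝ) ≠ 0 := by positivity
    rw [mean, mul_inv_cancel_left₀ this]

lemma mutualPressureTerm_eq {R : ℝ} {n N : ℕ} (ξ : Fin n → Fin N → Seg R) (f : C(Cube R n, ℝ)) :
    mutualPressureTerm ξ f = (N : ℝ)⁻¹ * Real.log (permAverage ξ f) := by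
  simp only [mutualPressureTerm, permAverage, natCast_mul_mean]

lemma permAverage_pos {R : ℝ} {n N : ℕ} (ξ : Fin n → Fin N → Seg R) (f : C(Cube R n, ℝ)) :
    0 < permAverage ξ f := by
  have h1 : (0 : ℝ) < N.factorial := by exact_mod_cast N.factorial_pos
  exact mul_pos (by positivity) (Finset.sum_pos (fun _ _ => Real.exp_pos _) Finset.univ_nonempty)

/-- The substitution `σ_i ↦ σ_i τ_i⁻¹` is a bijection. This allows samples to be sorted before they
are compared. -/
lemma permAverage_comp_perm {R : ℝ} {n N : ℕ} (ξ : Fin n → Fin N → Seg R)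
    (τ : Fin n → Equiv.Perm (Fin N)) (f : C(Cube R n, ℝ)) :
    permAverage (fun i => ξ i ∘ τ i) f = permAverage ξ f := by
  unfold permAverage
  congr 1
  refine Fintype.sum_equiv (Equiv.mulRight (fun i => (τ i)⁻¹)) _ _ fun σ => ?_
  simp

lemma sum_const_perm {n N : ℕ} (c : ℝ) :
    ((N.factorial : ℝ) ^ n)⁻¹ * ∑ _σ : Fin n → Equiv.Perm (Fin N), c = c := by
  have h1 : (N.factorial : ℝ) ≠ 0 := by exact_mod_cast N.factorial_ne_zero
  simp [Fintype.card_perm, h1]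

lemma permAverage_le_exp_mul {R : ℝ} {n N : ℕ} {x ξ : Fin n → Fin N → Seg R}
    {f f' : C(Cube R n, ℝ)} {D : ℝ}
    (h : ∀ σ : Fin n → Equiv.Perm (Fin N),
      (∑ j, f fun i => x i ((σ i)⁻¹ j)) ≤ (∑ j, f' fun i => ξ i ((σ i)⁻¹ j)) + D) :
    permAverage x f ≤ Real.exp D * permAverage ξ f' := by
  unfold permAverage
  rw [mul_left_comm (Real.exp D)]
  refine mul_le_mul_of_nonneg_left ?_ (by positivity)
  rw [Finset.mul_sum]
  refine Finset.sum_le_sum fun σ _ => ?_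
  rw [← Real.exp_add, Real.exp_le_exp, add_comm]
  exact h σ

/-- Comparison with the potential `0`, whose average is `1`. -/
lemma abs_mutualPressureTerm_le {R : ℝ} {n N : ℕ} (ξ : Fin n → Fin N → Seg R)
    (f : C(Cube R n, ℝ)) : |mutualPressureTerm ξ f| ≤ ‖f‖ := by
  have h0 : permAverage ξ (0 : C(Cube R n, ℝ)) = 1 := by
    simpa [permAverage] using sum_const_perm (n := n) (N := N) 1
  have hb : ∀ σ : Fin n → Equiv.Perm (Fin N),
      |∑ j, f fun i => ξ i ((σ i)⁻¹ j)| ≤ N * ‖f‖ := fun σ => by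
    refine (Finset.abs_sum_le_sum_abs _ _).trans ?_
    refine (Finset.sum_le_card_nsmul _ _ ‖f‖ fun j _ => f.norm_coe_le_norm _).trans (by simp)
  have hup : permAverage ξ f ≤ Real.exp (N * ‖f‖) * permAverage ξ 0 :=
    permAverage_le_exp_mul fun σ => by simpa using (abs_le.1 (hb σ)).2
  have hlo : permAverage ξ (0 : C(Cube R n, ℝ)) ≤ Real.exp (N * ‖f‖) * permAverage ξ f :=
    permAverage_le_exp_mul fun σ => by
      have := (abs_le.1 (hb σ)).1
      simp only [ContinuousMap.zero_apply, Finset.sum_const_zero]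
      linarith
  rw [h0] at hup hlo
  have hl : |Real.log (permAverage ξ f)| ≤ N * ‖f‖ := by
    rw [abs_le]
    constructor
    · have := Real.log_le_log one_pos hlo
      rw [Real.log_mul (Real.exp_pos _).ne' (permAverage_pos ξ f).ne', Real.log_exp,
        Real.log_one] at this
      linarith
    · have := Real.log_le_log (permAverage_pos ξ f) hup
      rwa [mul_one, Real.log_exp] at this
  rw [mutualPressureTerm_eq, abs_mul, abs_of_nonneg (by positivity : (0 : ℝ) ≤ (N : ℝ)⁻¹)]
  rcases Nat.eq_zero_or_pos N with rfl | hN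
  · simp
  · have : (0 : ℝ) < N := by positivity
    rw [inv_mul_le_iff₀ this]
    exact hl

/-! ### Increasing vectors with close statistics -/

/-- For increasing vectors, a monotone function that takes the value `0` at `ξ_j` and `1` at `x_j`
for many indices `j` separates the sums. -/
lemma card_filter_le_abs_sum_sub {α : Type*} [LinearOrder α] {N : ℕ} {x ξ : Fin N → α}
    (hx : Monotone x) (hξ : Monotone ξ) {φ : α → ℝ} (hφ : Monotone φ) (h0 : ∀ s, 0 ≤ φ s)
    (h1 : ∀ s, φ s ≤ 1) :
    ((Finset.univ.filter fun j => φ (ξ j) = 0 ∧ φ (x j) = 1).card : ℝ) ≤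
      |∑ j, φ (x j) - ∑ j, φ (ξ j)| := by
  classical
  rcases (Finset.univ.filter fun j => φ (ξ j) = 0 ∧ φ (x j) = 1).eq_empty_or_nonempty with
    he | ⟨j₀, hj₀⟩
  · simp [he]
  · refine le_trans ?_ (le_abs_self _)
    rw [← Finset.sum_sub_distrib, Finset.card_filter]
    push_cast
    simp only [Finset.mem_filter, Finset.mem_univ, true_and] at hj₀
    refine Finset.sum_le_sum fun j _ => ?_
    split_ifs with h
    · simp [h.1, h.2]
    -- The witness `j₀` forces `φ (ξ j) = 0` for `j ≤ j₀` and `φ (x j) = 1` for `j ≥ j₀`, so no term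
    -- of the difference is negative.
    · rcases le_total j j₀ with hj | hj
      · have := hφ (hξ hj)
        linarith [h0 (x j)]
      · have := hφ (hx hj)
        linarith [h1 (ξ j)]

/-- A continuous monotone function on `[-R, R]` that increases from `0` to `1` on an interval
of length `η / 2`. -/
def ramp (R η : ℝ) (k : ℕ) : C(Seg R, ℝ) :=
  ⟨fun s => max 0 (min 1 (((s : ℝ) + R) * (2 / η) - k)), by fun_prop⟩

lemma ramp_monotone {R η : ℝ} (hη : 0 < η) (k : ℕ) : Monotone (ramp R η k) := by
  intro a b hab
  have : (a : ℝ) ≤ b := hab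
  have h2 : 0 ≤ 2 / η := by positivity
  change max 0 (min 1 (((a : ℝ) + R) * (2 / η) - k)) ≤ max 0 (min 1 (((b : ℝ) + R) * (2 / η) - k))
  gcongr

/-- Ramp `k` climbs over the `k`-th cell of the grid of mesh `η / 2`, and an interval of length `η`
contains a whole cell. -/
lemma exists_ramp_separates {R η : ℝ} (hη : 0 < η) :
    ∃ K : ℕ, ∀ a b : Seg R, (a : ℝ) + η ≤ b →
      ∃ k < K, ramp R η k a = 0 ∧ ramp R η k b = 1 := by
  refine ⟨⌈(2 * R) * (2 / η)⌉₊ + 1, fun a b hab => ?_⟩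
  have h2 : 0 < 2 / η := by positivity
  set u := ((a : ℝ) + R) * (2 / η) with hu
  have hu0 : 0 ≤ u := mul_nonneg (by linarith [a.2.1]) h2.le
  have hub : u + 2 ≤ ((b : ℝ) + R) * (2 / η) := by
    have h3 : η * (2 / η) = 2 := by field_simp
    calc u + 2 = ((a : ℝ) + R + η) * (2 / η) := by rw [add_mul _ η, h3]
      _ ≤ _ := mul_le_mul_of_nonneg_right (by linarith) h2.le
  -- The first cell starting at or after `a`; it ends before `u + 2`, hence before `b`.
  refine ⟨⌈u⌉₊, Nat.lt_succ_of_le (Nat.ceil_mono ?_), ?_, ?_⟩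
  · rw [hu]; gcongr; linarith [a.2.2]
  · change max 0 (min 1 (u - (⌈u⌉₊ : ℝ))) = 0
    exact max_eq_left ((min_le_right _ _).trans (by linarith [Nat.le_ceil u]))
  · change max 0 (min 1 (((b : ℝ) + R) * (2 / η) - (⌈u⌉₊ : ℝ))) = 1
    rw [min_eq_left (by linarith [Nat.ceil_lt_add_one hu0])]
    simp

lemma ramp_nonneg (R η : ℝ) (k : ℕ) (s : Seg R) : 0 ≤ ramp R η k s := le_max_left _ _

lemma ramp_le_one (R η : ℝ) (k : ℕ) (s : Seg R) : ramp R η k s ≤ 1 :=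
  max_le zero_le_one (min_le_left _ _)

/-- Each distant index is charged to a ramp separating its two values and to a direction; each of
these `2K` classes has at most `D` members. -/
lemma card_dist_ge_le {R η : ℝ} (hη : 0 < η) {K : ℕ}
    (hK : ∀ a b : Seg R, (a : ℝ) + η ≤ b → ∃ k < K, ramp R η k a = 0 ∧ ramp R η k b = 1)
    {N : ℕ} {x ξ : Fin N → Seg R} (hx : Monotone x) (hξ : Monotone ξ) {D : ℝ}
    (hD : ∀ k < K, |∑ j, ramp R η k (x j) - ∑ j, ramp R η k (ξ j)| ≤ D) :
    ((Finset.univ.filter fun j => η ≤ dist (x j) (ξ j)).card : ℝ) ≤ 2 * K * D := by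
  classical
  have hsub : (Finset.univ.filter fun j => η ≤ dist (x j) (ξ j)) ⊆
      (Finset.range K).biUnion fun k =>
        (Finset.univ.filter fun j => ramp R η k (ξ j) = 0 ∧ ramp R η k (x j) = 1) ∪
        (Finset.univ.filter fun j => ramp R η k (x j) = 0 ∧ ramp R η k (ξ j) = 1) := by
    intro j hj
    simp only [Finset.mem_filter, Finset.mem_univ, true_and] at hj
    simp only [Finset.mem_biUnion, Finset.mem_range, Finset.mem_union, Finset.mem_filter,
      Finset.mem_univ, true_and]
    rw [Subtype.dist_eq, Real.dist_eq, le_abs] at hj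
    rcases hj with hj | hj
    · obtain ⟨k, hk, h⟩ := hK (ξ j) (x j) (by linarith)
      exact ⟨k, hk, Or.inl h⟩
    · obtain ⟨k, hk, h⟩ := hK (x j) (ξ j) (by linarith)
      exact ⟨k, hk, Or.inr h⟩
  have h1 := (Finset.card_le_card hsub).trans Finset.card_biUnion_le
  have h2 : ∀ k ∈ Finset.range K,
      (((Finset.univ.filter fun j => ramp R η k (ξ j) = 0 ∧ ramp R η k (x j) = 1) ∪
        (Finset.univ.filter fun j => ramp R η k (x j) = 0 ∧ ramp R η k (ξ j) = 1)).card : ℝ)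
        ≤ 2 * D := by
    intro k hk
    have hk := hD k (Finset.mem_range.1 hk)
    have ha := card_filter_le_abs_sum_sub hx hξ (ramp_monotone hη k) (ramp_nonneg R η k)
      (ramp_le_one R η k)
    have hb := card_filter_le_abs_sum_sub hξ hx (ramp_monotone hη k) (ramp_nonneg R η k)
      (ramp_le_one R η k)
    rw [abs_sub_comm] at hb
    have hc := Finset.card_union_le
      (Finset.univ.filter fun j => ramp R η k (ξ j) = 0 ∧ ramp R η k (x j) = 1)
      (Finset.univ.filter fun j => ramp R η k (x j) = 0 ∧ ramp R η k (ξ j) = 1)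
    have hc' : ((_ : ℕ) : ℝ) ≤ ((_ : ℕ) : ℝ) := Nat.cast_le.2 hc
    push_cast at hc'
    linarith
  calc ((Finset.univ.filter fun j => η ≤ dist (x j) (ξ j)).card : ℝ)
      ≤ ∑ k ∈ Finset.range K,
        (((Finset.univ.filter fun j => ramp R η k (ξ j) = 0 ∧ ramp R η k (x j) = 1) ∪
        (Finset.univ.filter fun j => ramp R η k (x j) = 0 ∧ ramp R η k (ξ j) = 1)).card : ℝ) := by
        exact_mod_cast h1
    _ ≤ ∑ _k ∈ Finset.range K, 2 * D := Finset.sum_le_sum h2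
    _ = 2 * K * D := by simp; ring

/-- An index whose coordinates are all `η`-close costs `δ`, any other at most `2‖f‖`. Permutations
do not change the number of distant entries per coordinate. -/
lemma abs_sum_sub_le_of_card_dist_ge {R : ℝ} {n N : ℕ} (f : C(Cube R n, ℝ)) {η δ B : ℝ}
    (hδ : 0 ≤ δ) (hη : 0 < η) (hf : ∀ a b : Cube R n, dist a b < η → |f a - f b| ≤ δ)
    {x ξ : Fin n → Fin N → Seg R}
    (hB : ∀ i, ((Finset.univ.filter fun j => η ≤ dist (x i j) (ξ i j)).card : ℝ) ≤ B)
    (σ : Fin n → Equiv.Perm (Fin N)) :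
    |(∑ j, f fun i => x i ((σ i)⁻¹ j)) - ∑ j, f fun i => ξ i ((σ i)⁻¹ j)| ≤
      N * δ + 2 * ‖f‖ * (n * B) := by
  classical
  have hj : ∀ j : Fin N, |(f fun i => x i ((σ i)⁻¹ j)) - f fun i => ξ i ((σ i)⁻¹ j)| ≤
      δ + ∑ i, if η ≤ dist (x i ((σ i)⁻¹ j)) (ξ i ((σ i)⁻¹ j)) then 2 * ‖f‖ else 0 := by
    intro j
    have hnn : ∀ i ∈ Finset.univ, (0 : ℝ) ≤
        if η ≤ dist (x i ((σ i)⁻¹ j)) (ξ i ((σ i)⁻¹ j)) then 2 * ‖f‖ else 0 := by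
      intro i _; split_ifs <;> positivity
    by_cases h : ∃ i, η ≤ dist (x i ((σ i)⁻¹ j)) (ξ i ((σ i)⁻¹ j))
    · obtain ⟨i, hi⟩ := h
      have h1 := Finset.single_le_sum hnn (Finset.mem_univ i)
      rw [if_pos hi] at h1
      have h2 := f.norm_coe_le_norm fun i => x i ((σ i)⁻¹ j)
      have h3 := f.norm_coe_le_norm fun i => ξ i ((σ i)⁻¹ j)
      rw [Real.norm_eq_abs] at h2 h3
      have h4 := abs_sub (f fun i => x i ((σ i)⁻¹ j)) (f fun i => ξ i ((σ i)⁻¹ j))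
      linarith
    · push Not at h
      have := hf (fun i => x i ((σ i)⁻¹ j)) (fun i => ξ i ((σ i)⁻¹ j))
        ((dist_pi_lt_iff hη).2 h)
      linarith [Finset.sum_nonneg hnn]
  rw [← Finset.sum_sub_distrib]
  refine (Finset.abs_sum_le_sum_abs _ _).trans ((Finset.sum_le_sum fun j _ => hj j).trans ?_)
  rw [Finset.sum_add_distrib, Finset.sum_comm]
  have hi : ∀ i ∈ Finset.univ, (∑ j, if η ≤ dist (x i ((σ i)⁻¹ j)) (ξ i ((σ i)⁻¹ j))
      then 2 * ‖f‖ else 0) ≤ 2 * ‖f‖ * B := by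
    intro i _
    rw [Equiv.sum_comp (σ i)⁻¹ fun j => if η ≤ dist (x i j) (ξ i j) then 2 * ‖f‖ else 0,
      ← Finset.sum_filter, Finset.sum_const, nsmul_eq_mul, mul_comm]
    have := hB i
    gcongr
  refine (add_le_add_right (Finset.sum_le_sum hi) _).trans (le_of_eq ?_)
  simp
  ring

/-- The average over permutations depends only, up to a factor `e^{δ N}`, on finitely many
statistics of the vectors. -/
lemma exists_permAverage_comparison {R : ℝ} {n : ℕ} (f : C(Cube R n, ℝ)) {δ : ℝ} (hδ : 0 < δ) :
    ∃ (K : ℕ) (φ : Fin K → C(Seg R, ℝ)) (ε : ℝ), 0 < ε ∧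
      ∀ (N : ℕ) (x ξ : Fin n → Fin N → Seg R), (∀ i, Monotone (ξ i)) →
        (∀ i k, |∑ j, φ k (x i j) - ∑ j, φ k (ξ i j)| ≤ N * ε) →
        permAverage x f ≤ Real.exp (N * δ) * permAverage ξ f ∧
        permAverage ξ f ≤ Real.exp (N * δ) * permAverage x f := by
  have huc := CompactSpace.uniformContinuous_of_continuous f.continuous
  obtain ⟨η, hη, hf⟩ := Metric.uniformContinuous_iff.1 huc (δ / 2) (by positivity)
  obtain ⟨K, hK⟩ := exists_ramp_separates (R := R) hη
  -- The distant indices cost at most `2‖f‖ · n · 2K · Nε`, which this `ε` keeps below `Nδ/2`; the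
  -- `+ 1` guards against a zero denominator.
  refine ⟨K, fun k => ramp R η k, δ / 2 / (4 * ‖f‖ * n * K + 1), by positivity, ?_⟩
  set ε := δ / 2 / (4 * ‖f‖ * n * K + 1) with hε
  intro N x ξ hξ hφ
  have hεle : (4 * ‖f‖ * n * K) * ε ≤ δ / 2 := by
    have h0 : 0 < 4 * ‖f‖ * n * K + 1 := by positivity
    have : (4 * ‖f‖ * n * K + 1) * ε = δ / 2 := by rw [hε]; field_simp
    have : 0 < ε := by rw [hε]; positivity
    nlinarith
  -- Only `ξ` is assumed increasing; sorting `x` changes neither its statistics nor its permutation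
  -- average.
  set y : Fin n → Fin N → Seg R := fun i => x i ∘ Tuple.sort (x i) with hy
  rw [← permAverage_comp_perm x (fun i => Tuple.sort (x i)) f]
  have hB : ∀ i, ((Finset.univ.filter fun j => η ≤ dist (y i j) (ξ i j)).card : ℝ) ≤
      2 * K * (N * ε) := fun i => by
    refine card_dist_ge_le hη hK (Tuple.monotone_sort (x i)) (hξ i) fun k hk => ?_
    have := hφ i ⟨k, hk⟩
    rwa [← Equiv.sum_comp (Tuple.sort (x i))] at this
  have hσ := abs_sum_sub_le_of_card_dist_ge f (half_pos hδ).le hη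
    (fun a b hab => (hf hab).le) hB
  have hD : N * (δ / 2) + 2 * ‖f‖ * (n * (2 * K * (N * ε))) ≤ N * δ := by
    have : (0 : ℝ) ≤ N := by positivity
    nlinarith
  constructor
  · exact permAverage_le_exp_mul fun σ => by
      have := (abs_le.1 (hσ σ)).2
      linarith
  · exact permAverage_le_exp_mul fun σ => by
      have := (abs_le.1 (hσ σ)).1
      linarith

/-! ### Exchangeability and change of measure for i.i.d. samples -/

lemma _root_.ContinuousMap.integrable_of_compactSpace {X : Type*} [TopologicalSpace X] [CompactSpace X]
    [MeasurableSpace X] [OpensMeasurableSpace X] (f : C(X, ℝ)) (μ : Measure X)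
    [IsFiniteMeasure μ] : Integrable f μ :=
  f.continuous.integrable_of_hasCompactSupport (HasCompactSupport.of_compactSpace _)

lemma _root_.Continuous.integrable_of_compactSpace {X : Type*} [TopologicalSpace X] [CompactSpace X]
    [MeasurableSpace X] [OpensMeasurableSpace X] {f : X → ℝ} (hf : Continuous f) (μ : Measure X)
    [IsFiniteMeasure μ] : Integrable f μ :=
  hf.integrable_of_hasCompactSupport (HasCompactSupport.of_compactSpace _)

lemma measurePreserving_curry_pi {N n : ℕ} {X : Type*} [MeasurableSpace X]
    (ν : Fin n → Measure X) [∀ i, IsProbabilityMeasure (ν i)] :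
    MeasurePreserving (MeasurableEquiv.curry (Fin N) (Fin n) X)
      (Measure.pi fun p : Fin N × Fin n => ν p.2) (Measure.pi fun _ : Fin N => Measure.pi ν) := by
  refine ⟨MeasurableEquiv.measurable _, ?_⟩
  have h := Measure.infinitePi_map_curry (fun (_ : Fin N) i => ν i)
  simpa only [Measure.infinitePi_eq_pi] using h

lemma measurePreserving_comp_equiv {ι X : Type*} [Fintype ι] [MeasurableSpace X]
    (ν : ι → Measure X) [∀ i, IsProbabilityMeasure (ν i)] (e : ι ≃ ι)
    (he : ∀ i, ν (e i) = ν i) :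
    MeasurePreserving (fun (w : ι → X) p => w (e p)) (Measure.pi ν) (Measure.pi ν) := by
  have hm : Measurable fun (w : ι → X) p => w (e p) := by fun_prop
  refine ⟨hm, (Measure.pi_eq fun s hs => ?_).symm⟩
  have hpre : (fun (w : ι → X) p => w (e p)) ⁻¹' Set.univ.pi s =
      Set.univ.pi fun q => s (e.symm q) := by
    ext w
    simp only [Set.mem_preimage, Set.mem_pi, Set.mem_univ, true_imp_iff]
    exact ⟨fun h q => by simpa using h (e.symm q), fun h p => by simpa using h (e p)⟩
  rw [Measure.map_apply hm (MeasurableSet.univ_pi hs), hpre, Measure.pi_pi]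
  refine (Fintype.prod_equiv e _ _ fun p => ?_).symm
  simp [he]

/-- Independent permutations of the samples of the coordinates preserve the law of an i.i.d.
sample from a product measure. -/
lemma measurePreserving_permCoord {N n : ℕ} {X : Type*} [MeasurableSpace X]
    (ν : Fin n → Measure X) [∀ i, IsProbabilityMeasure (ν i)]
    (σ : Fin n → Equiv.Perm (Fin N)) :
    MeasurePreserving (fun (y : Fin N → Fin n → X) j i => y (σ i j) i)
      (Measure.pi fun _ : Fin N => Measure.pi ν) (Measure.pi fun _ : Fin N => Measure.pi ν) := by
  -- This permutation of the entries preserves the coordinate index, hence the law of each entry.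
  let e : Fin N × Fin n ≃ Fin N × Fin n :=
    ⟨fun p => (σ p.2 p.1, p.2), fun p => ((σ p.2)⁻¹ p.1, p.2), fun p => by simp,
      fun p => by simp⟩
  have hc := measurePreserving_curry_pi (N := N) ν
  exact hc.comp ((measurePreserving_comp_equiv (fun p : Fin N × Fin n => ν p.2) e
    fun _ => rfl).comp (hc.symm _))

/-- By invariance of the law and of `A`, all terms of the permutation average have the same integral
over `A`. -/
lemma setIntegral_exp_sum_eq_permAverage {R : ℝ} {n N : ℕ} (ν : Fin n → Measure (Seg R))
    [∀ i, IsProbabilityMeasure (ν i)] (f : C(Cube R n, ℝ)) {A : Set (Fin N → Cube R n)}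
    (hA : MeasurableSet A)
    (hinv : ∀ (σ : Fin n → Equiv.Perm (Fin N)) (y : Fin N → Cube R n),
      (fun j i => y (σ i j) i) ∈ A ↔ y ∈ A) :
    ∫ y in A, Real.exp (∑ j, f (y j)) ∂(Measure.pi fun _ : Fin N => Measure.pi ν) =
      ∫ y in A, permAverage (fun i j => y j i) f
        ∂(Measure.pi fun _ : Fin N => Measure.pi ν) := by
  have hF : Continuous fun y : Fin N → Cube R n => Real.exp (∑ j, f (y j)) := by fun_prop
  have hperm : ∀ σ : Fin n → Equiv.Perm (Fin N),
      ∫ y in A, Real.exp (∑ j, f fun i => y ((σ i)⁻¹ j) i)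
        ∂(Measure.pi fun _ : Fin N => Measure.pi ν) =
      ∫ y in A, Real.exp (∑ j, f (y j)) ∂(Measure.pi fun _ : Fin N => Measure.pi ν) := by
    intro σ
    have hT := measurePreserving_permCoord (N := N) ν fun i => (σ i)⁻¹
    have h1 := setIntegral_map hA (f := fun y : Fin N → Cube R n => Real.exp (∑ j, f (y j)))
      hF.aestronglyMeasurable hT.aemeasurable
    rw [hT.map_eq] at h1
    rw [h1]
    congr 2
    ext y
    exact (hinv _ y).symm
  simp only [permAverage]
  rw [integral_const_mul, integral_finsetSum]
  · simp only [hperm]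
    rw [sum_const_perm]
  · intro σ _
    have hc : Continuous fun y : Fin N → Cube R n =>
        Real.exp (∑ j, f fun i => y ((σ i)⁻¹ j) i) := by fun_prop
    exact hc.integrable_of_compactSpace _

lemma pi_withDensity_exp {ι : Type*} [Fintype ι] {X : ι → Type*} [∀ i, MeasurableSpace (X i)]
    (μ : ∀ i, Measure (X i)) [∀ i, IsFiniteMeasure (μ i)] (v : ∀ i, X i → ℝ)
    (hint : ∀ i, Integrable (fun x => Real.exp (v i x)) (μ i)) :
    (Measure.pi fun i => (μ i).withDensity fun x => ENNReal.ofReal (Real.exp (v i x))) =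
      (Measure.pi μ).withDensity fun x => ENNReal.ofReal (Real.exp (∑ i, v i (x i))) := by
  have : ∀ i, SigmaFinite ((μ i).withDensity fun x => ENNReal.ofReal (Real.exp (v i x))) :=
    fun i => inferInstance
  refine Measure.pi_eq fun s hs => ?_
  simp only [withDensity_apply _ (MeasurableSet.univ_pi hs), withDensity_apply _ (hs _),
    Measure.restrict_pi_pi, Real.exp_sum]
  rw [← ofReal_integral_eq_lintegral_ofReal
      (Integrable.fintype_prod_dep fun i => (hint i).restrict)
      (ae_of_all _ fun x => Finset.prod_nonneg fun i _ => (Real.exp_pos _).le),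
    integral_fintype_prod_eq_prod (fun i x => Real.exp (v i x)),
    ENNReal.ofReal_prod_of_nonneg fun i _ => integral_nonneg fun x => (Real.exp_pos _).le]
  refine Finset.prod_congr rfl fun i _ => ?_
  exact ofReal_integral_eq_lintegral_ofReal (hint i).restrict
    (ae_of_all _ fun x => (Real.exp_pos _).le)

/-- The `N`-fold product of `G` has density `exp ∑ g (y j)`, which cancels the `-g`. -/
lemma setIntegral_exp_sum_tilt {R : ℝ} {n N : ℕ} (π G : Measure (Cube R n))
    [IsProbabilityMeasure π] (f g : C(Cube R n, ℝ))
    (hG : G = π.withDensity fun x => ENNReal.ofReal (Real.exp (g x)))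
    {A : Set (Fin N → Cube R n)} (hA : MeasurableSet A) :
    ∫ y in A, Real.exp (∑ j, (f - g) (y j)) ∂(Measure.pi fun _ : Fin N => G) =
      ∫ y in A, Real.exp (∑ j, f (y j)) ∂(Measure.pi fun _ : Fin N => π) := by
  rw [hG, pi_withDensity_exp (fun _ : Fin N => π) (fun _ => g)
    (fun _ => (Continuous.integrable_of_compactSpace (by fun_prop) _))]
  rw [setIntegral_withDensity_eq_setIntegral_toReal_smul (by fun_prop)
    (ae_of_all _ fun _ => ENNReal.ofReal_lt_top) _ hA]
  refine integral_congr_ae (ae_of_all _ fun y => ?_)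
  simp only [smul_eq_mul]
  rw [ENNReal.toReal_ofReal (Real.exp_pos _).le, ← Real.exp_add, ← Finset.sum_add_distrib]
  simp

lemma integral_exp_sum_pi {R : ℝ} {n N : ℕ} (π : Measure (Cube R n)) [IsProbabilityMeasure π]
    (f : C(Cube R n, ℝ)) :
    ∫ y, Real.exp (∑ j, f (y j)) ∂(Measure.pi fun _ : Fin N => π) =
      (∫ x, Real.exp (f x) ∂π) ^ N := by
  simp only [Real.exp_sum]
  rw [integral_fintype_prod_eq_prod (fun _ x => Real.exp (f x))]
  simp

/-! ### Law of large numbers and typical samples -/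

/-- The weak law of large numbers, for deviations from a sequence converging to the mean. -/
lemma tendsto_pi_abs_sum_sub_gt {X : Type*} [MeasurableSpace X] (Q : Measure X)
    [IsProbabilityMeasure Q] {ψ : X → ℝ} (hψ : MemLp ψ 2 Q) {c : ℕ → ℝ}
    (hc : Tendsto c atTop (𝓝 (∫ x, ψ x ∂Q))) {ε : ℝ} (hε : 0 < ε) :
    Tendsto (fun N : ℕ => (Measure.pi fun _ : Fin N => Q)
      {y | N * ε < |∑ j, ψ (y j) - N * c N|}) atTop (𝓝 0) := by
  set m := ∫ x, ψ x ∂Q with hm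
  set V := ProbabilityTheory.variance ψ Q
  -- Chebyshev's bound for deviations `N ε / 2`; the other half of `ε` absorbs `c N - m`.
  have hlim : Tendsto (fun N : ℕ => ENNReal.ofReal (V / (ε / 2) ^ 2 * (N : ℝ)⁻¹)) atTop (𝓝 0) := by
    rw [← ENNReal.ofReal_zero]
    refine ENNReal.tendsto_ofReal ?_
    simpa using (tendsto_inv_atTop_nhds_zero_nat (𝕜 := ℝ)).const_mul (V / (ε / 2) ^ 2)
  refine tendsto_of_tendsto_of_tendsto_of_le_of_le' tendsto_const_nhds hlim
    (Eventually.of_forall fun _ => zero_le) ?_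
  filter_upwards [Metric.tendsto_nhds.1 hc (ε / 2) (by positivity), eventually_gt_atTop 0]
    with N hN hN0
  have hNpos : (0 : ℝ) < N := by exact_mod_cast hN0
  have hL : ∀ j : Fin N, MemLp (fun y : Fin N → X => ψ (y j)) 2 (Measure.pi fun _ : Fin N => Q) :=
    fun j => hψ.comp_measurePreserving (measurePreserving_eval (fun _ : Fin N => Q) j)
  have hmean : ∫ y, ∑ j, ψ (y j) ∂(Measure.pi fun _ : Fin N => Q) = N * m := by
    rw [integral_finsetSum _ fun j _ => (hL j).integrable (by norm_num)]
    simp [integral_comp_eval (μ := fun _ : Fin N => Q) hψ.aestronglyMeasurable, ← hm]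
  have hvar := ProbabilityTheory.variance_sum_pi (μ := fun _ : Fin N => Q) (X := fun _ => ψ)
    fun _ => hψ
  have hsum : (∑ j : Fin N, fun y : Fin N → X => ψ (y j)) = fun y => ∑ j, ψ (y j) := by
    ext y; simp
  rw [hsum] at hvar
  have hch := ProbabilityTheory.meas_ge_le_variance_div_sq
    (memLp_finsetSum Finset.univ fun j _ => hL j) (c := N * (ε / 2)) (by positivity)
  rw [hmean, hvar] at hch
  refine (measure_mono ?_).trans (hch.trans (le_of_eq ?_))
  · intro y hy
    simp only [Set.mem_ofPred_eq] at hy ⊢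
    rw [Real.dist_eq] at hN
    have h1 : |(N : ℝ) * c N - N * m| ≤ N * (ε / 2) := by
      rw [← mul_sub, abs_mul, abs_of_pos hNpos]
      gcongr
    have h2 := abs_sub_le (∑ j, ψ (y j)) (N * m) (N * c N)
    rw [abs_sub_comm ((N : ℝ) * m)] at h2
    linarith
  · congr 1
    simp only [Finset.sum_const, Finset.card_univ, Fintype.card_fin, nsmul_eq_mul]
    change N * V / _ = _
    field_simp

/-- Union bound over finitely many statistics. A constant such as `1/2` disappears after taking
`(1/N) log`. -/
lemma eventually_half_le_pi_of_finite {X κ : Type*} [MeasurableSpace X] [Finite κ]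
    (Q : Measure X) [IsProbabilityMeasure Q] (ψ : κ → X → ℝ) (hm : ∀ k, Measurable (ψ k))
    (hψ : ∀ k, MemLp (ψ k) 2 Q) (c : κ → ℕ → ℝ)
    (hc : ∀ k, Tendsto (c k) atTop (𝓝 (∫ x, ψ k x ∂Q))) {ε : ℝ} (hε : 0 < ε) :
    ∀ᶠ N : ℕ in atTop, 1 / 2 ≤ (Measure.pi fun _ : Fin N => Q).real
      {y | ∀ k, |∑ j, ψ k (y j) - N * c k N| ≤ N * ε} := by
  have := Fintype.ofFinite κ
  have hlim : Tendsto (fun N : ℕ => ∑ k, (Measure.pi fun _ : Fin N => Q)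
      {y | N * ε < |∑ j, ψ k (y j) - N * c k N|}) atTop (𝓝 0) := by
    simpa using tendsto_finsetSum Finset.univ fun k _ =>
      tendsto_pi_abs_sum_sub_gt Q (hψ k) (hc k) hε
  have hhalf : (0 : ENNReal) < ENNReal.ofReal (1 / 2) := by simp
  filter_upwards [hlim.eventually_lt_const hhalf] with N hN
  have hms : MeasurableSet {y : Fin N → X | ∀ k, |∑ j, ψ k (y j) - N * c k N| ≤ N * ε} := by
    rw [Set.ofPred_forall]
    exact MeasurableSet.iInter fun k => measurableSet_le (by fun_prop) (by fun_prop)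
  have hcompl : {y : Fin N → X | ∀ k, |∑ j, ψ k (y j) - N * c k N| ≤ N * ε}ᶜ =
      ⋃ k, {y | N * ε < |∑ j, ψ k (y j) - N * c k N|} := by
    ext y; simp
  have h1 : (Measure.pi fun _ : Fin N => Q).real
      {y : Fin N → X | ∀ k, |∑ j, ψ k (y j) - N * c k N| ≤ N * ε}ᶜ ≤ 1 / 2 := by
    rw [hcompl, measureReal_def]
    refine ENNReal.toReal_le_of_le_ofReal (by norm_num) ?_
    refine (measure_iUnion_le _).trans ?_
    rw [tsum_fintype]
    exact hN.le
  rw [probReal_compl_eq_one_sub hms] at h1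
  linarith

/-- Linearity passes from moments to polynomials, and the Weierstrass theorem to continuous
functions. -/
lemma IsApproximating.tendsto_mean {R : ℝ} {n : ℕ} {Ξ : (N : ℕ) → Fin n → Fin N → Seg R}
    {ν : Fin n → Measure (Seg R)} [∀ i, IsProbabilityMeasure (ν i)] (hΞ : IsApproximating Ξ ν)
    (i : Fin n) (φ : C(Seg R, ℝ)) :
    Tendsto (fun N => mean fun j => φ (Ξ N i j)) atTop (𝓝 (∫ x, φ x ∂ν i)) := by
  have hpoly : ∀ p : Polynomial ℝ, Tendsto (fun N => mean fun j => p.eval (Ξ N i j : ℝ)) atTop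
      (𝓝 (∫ x, p.eval (x : ℝ) ∂ν i)) := by
    intro p
    simp only [Polynomial.eval_eq_sum_range]
    rw [integral_finsetSum]
    · have h1 : (fun N => mean fun j : Fin N =>
          ∑ k ∈ Finset.range (p.natDegree + 1), p.coeff k * (Ξ N i j : ℝ) ^ k) =
          fun N => ∑ k ∈ Finset.range (p.natDegree + 1),
            p.coeff k * mean fun j : Fin N => (Ξ N i j : ℝ) ^ k := by
        ext N
        simp only [mean]
        rw [Finset.sum_comm, Finset.mul_sum]
        refine Finset.sum_congr rfl fun k _ => ?_
        rw [← Finset.mul_sum]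
        ring
      rw [h1]
      refine tendsto_finsetSum _ fun k _ => ?_
      rw [integral_const_mul]
      exact (hΞ.tendsto_moment i k).const_mul _
    · intro k _
      exact Continuous.integrable_of_compactSpace (by fun_prop) _
  -- The strict form `N > M` ensures `N ≠ 0`, needed to bound the mean.
  rw [Metric.tendsto_atTop']
  intro ε hε
  obtain ⟨p, hp⟩ := exists_polynomial_near_continuousMap (-R) R φ (ε / 3) (by positivity)
  have hp' : ∀ x : Seg R, |p.eval (x : ℝ) - φ x| ≤ ε / 3 := fun x => by
    have := (p.toContinuousMapOn (Set.Icc (-R) R) - φ).norm_coe_le_norm x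
    simpa using this.trans hp.le
  obtain ⟨M, hM⟩ := Metric.tendsto_atTop'.1 (hpoly p) (ε / 3) (by positivity)
  refine ⟨M, fun N hN => ?_⟩
  have h1 := hM N hN
  rw [Real.dist_eq] at h1 ⊢
  have hN0 : (0 : ℝ) < N := by exact_mod_cast (Nat.zero_le M).trans_lt hN
  have h2 : |(mean fun j => p.eval (Ξ N i j : ℝ)) - mean fun j => φ (Ξ N i j)| ≤ ε / 3 := by
    simp only [mean]
    rw [← mul_sub, ← Finset.sum_sub_distrib, abs_mul, abs_of_pos (inv_pos.2 hN0),
      inv_mul_le_iff₀ hN0]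
    refine (Finset.abs_sum_le_sum_abs _ _).trans ?_
    refine (Finset.sum_le_card_nsmul _ _ (ε / 3) fun j _ => hp' _).trans (by simp)
  have h3 : |(∫ x, p.eval (x : ℝ) ∂ν i) - ∫ x, φ x ∂ν i| ≤ ε / 3 := by
    rw [← integral_sub (Continuous.integrable_of_compactSpace (by fun_prop) _)
      (φ.integrable_of_compactSpace _)]
    have := norm_integral_le_of_norm_le_const (μ := ν i) (f := fun x : Seg R => p.eval (x : ℝ) - φ x)
      (C := ε / 3) (ae_of_all _ hp')
    simpa using this
  rw [abs_le] at h2 h3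
  rw [abs_lt] at h1 ⊢
  constructor <;> linarith [h1.1, h1.2, h2.1, h2.2, h3.1, h3.2]

/-- The samples whose coordinates have nearly the same `φ`-statistics as `ξ`. -/
def typicalSet {R : ℝ} {n N K : ℕ} (ξ : Fin n → Fin N → Seg R) (φ : Fin K → C(Seg R, ℝ))
    (ε : ℝ) : Set (Fin N → Cube R n) :=
  {y | ∀ i k, |∑ j, φ k (y j i) - ∑ j, φ k (ξ i j)| ≤ N * ε}

lemma measurableSet_typicalSet {R : ℝ} {n N K : ℕ} (ξ : Fin n → Fin N → Seg R)
    (φ : Fin K → C(Seg R, ℝ)) (ε : ℝ) : MeasurableSet (typicalSet ξ φ ε) := by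
  simp only [typicalSet, Set.ofPred_forall]
  refine MeasurableSet.iInter fun i => MeasurableSet.iInter fun k => ?_
  refine measurableSet_le (Continuous.measurable ?_) measurable_const
  fun_prop

lemma permCoord_mem_typicalSet {R : ℝ} {n N K : ℕ} (ξ : Fin n → Fin N → Seg R)
    (φ : Fin K → C(Seg R, ℝ)) (ε : ℝ) (σ : Fin n → Equiv.Perm (Fin N))
    (y : Fin N → Cube R n) :
    (fun j i => y (σ i j) i) ∈ typicalSet ξ φ ε ↔ y ∈ typicalSet ξ φ ε := by
  simp only [typicalSet, Set.mem_ofPred_eq]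
  refine forall_congr' fun i => forall_congr' fun k => ?_
  rw [Equiv.sum_comp (σ i) fun j => φ k (y j i)]

lemma eventually_half_le_typicalSet {R : ℝ} {n K : ℕ} {Ξ : (N : ℕ) → Fin n → Fin N → Seg R}
    {Q : Measure (Cube R n)} [IsProbabilityMeasure Q] (hΞ : IsApproximating Ξ (marginal Q))
    (φ : Fin K → C(Seg R, ℝ)) (ψ : C(Cube R n, ℝ)) {ε δ : ℝ} (hε : 0 < ε) (hδ : 0 < δ) :
    ∀ᶠ N : ℕ in atTop, 1 / 2 ≤ (Measure.pi fun _ : Fin N => Q).real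
      (typicalSet (Ξ N) φ ε ∩ {y | |∑ j, ψ (y j) - N * ∫ x, ψ x ∂Q| ≤ N * δ}) := by
  have hev : ∀ i, Measurable fun x : Cube R n => x i := fun i => measurable_pi_apply i
  have : ∀ i, IsProbabilityMeasure (marginal Q i) := fun i =>
    Measure.isProbabilityMeasure_map (hev i).aemeasurable
  -- `none` carries `ψ`; `some (i, k)` carries the statistic `φ k` of coordinate `i`.
  let Ψ : Option (Fin n × Fin K) → C(Cube R n, ℝ) := fun o =>
    o.elim ψ fun p => (φ p.2).comp ⟨fun x => x p.1, by fun_prop⟩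
  let c : Option (Fin n × Fin K) → ℕ → ℝ := fun o N =>
    o.elim (∫ x, ψ x ∂Q) fun p => mean fun j => φ p.2 (Ξ N p.1 j)
  have hc : ∀ k, Tendsto (c k) atTop (𝓝 (∫ x, Ψ k x ∂Q)) := by
    rintro (_ | ⟨i, k⟩)
    · exact tendsto_const_nhds
    · have h1 := hΞ.tendsto_mean i (φ k)
      rw [marginal, integral_map (hev i).aemeasurable
        (φ k).continuous.aestronglyMeasurable] at h1
      exact h1
  have hL : ∀ k, MemLp (Ψ k) 2 Q := fun k =>
    MemLp.of_bound (Ψ k).continuous.aestronglyMeasurable ‖Ψ k‖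
      (ae_of_all _ fun x => (Ψ k).norm_coe_le_norm x)
  filter_upwards [eventually_half_le_pi_of_finite Q (fun k => Ψ k)
    (fun k => (Ψ k).continuous.measurable) hL c hc (lt_min hε hδ)] with N hN
  refine hN.trans (measureReal_mono ?_)
  intro y hy
  have hN0 : (0 : ℝ) ≤ N := by positivity
  refine ⟨fun i k => ?_, ?_⟩
  · have h1 : |∑ j, φ k (y j i) - N * mean fun j => φ k (Ξ N i j)| ≤ N * min ε δ :=
      hy (some (i, k))
    rw [natCast_mul_mean] at h1
    exact h1.trans (mul_le_mul_of_nonneg_left (min_le_left _ _) hN0)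
  · exact (hy none).trans (mul_le_mul_of_nonneg_left (min_le_right _ _) hN0)

/-! ### The two bounds on the pressure terms -/

lemma eventually_log_two_div_le {δ : ℝ} (hδ : 0 < δ) :
    ∀ᶠ N : ℕ in atTop, 0 < (N : ℝ) ∧ Real.log 2 ≤ N * δ := by
  filter_upwards [tendsto_natCast_atTop_atTop.eventually_gt_atTop (0 : ℝ),
    (tendsto_natCast_atTop_atTop.atTop_mul_const hδ).eventually_ge_atTop (Real.log 2)]
    with N h1 h2 using ⟨h1, h2⟩

/-- Integrate the average over typical samples of `⊗ν`, then enlarge the domain to all samples,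
where the integral factorises. -/
lemma eventually_mutualPressureTerm_le {R : ℝ} {n : ℕ} {Ξ : (N : ℕ) → Fin n → Fin N → Seg R}
    (ν : Fin n → Measure (Seg R)) [∀ i, IsProbabilityMeasure (ν i)] (hΞ : IsApproximating Ξ ν)
    (f : C(Cube R n, ℝ)) {δ : ℝ} (hδ : 0 < δ) :
    ∀ᶠ N in atTop, mutualPressureTerm (Ξ N) f ≤
      Real.log (∫ x, Real.exp (f x) ∂(Measure.pi ν)) + δ := by
  obtain ⟨K, φ, ε, hε, hcmp⟩ := exists_permAverage_comparison f (half_pos hδ)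
  have hmarg : marginal (Measure.pi ν) = ν :=
    funext fun i => (measurePreserving_eval ν i).map_eq
  have hI : 0 < ∫ x, Real.exp (f x) ∂(Measure.pi ν) :=
    integral_exp_pos (Continuous.integrable_of_compactSpace (by fun_prop) _)
  -- No extra test function is needed here, hence `0`.
  filter_upwards [eventually_half_le_typicalSet (Q := Measure.pi ν) (hmarg.symm ▸ hΞ) φ 0 hε
    one_pos, eventually_log_two_div_le (half_pos hδ)] with N hN hN2
  obtain ⟨hN0, hN2⟩ := hN2
  set P := Measure.pi fun _ : Fin N => Measure.pi ν with hP
  set A := typicalSet (Ξ N) φ ε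
  have hA : 1 / 2 ≤ P.real A := hN.trans (measureReal_mono Set.inter_subset_left)
  have hAm : MeasurableSet A := measurableSet_typicalSet _ _ _
  have hpc : Continuous fun y : Fin N → Cube R n => permAverage (fun i j => y j i) f := by
    unfold permAverage; fun_prop
  have hec : Continuous fun y : Fin N → Cube R n => Real.exp (∑ j, f (y j)) := by fun_prop
  have h1 : permAverage (Ξ N) f * P.real A ≤
      Real.exp (N * (δ / 2)) * (∫ x, Real.exp (f x) ∂(Measure.pi ν)) ^ N := by
    calc permAverage (Ξ N) f * P.real A = ∫ y in A, permAverage (Ξ N) f ∂P := by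
          simp [mul_comm]
      _ ≤ ∫ y in A, Real.exp (N * (δ / 2)) * permAverage (fun i j => y j i) f ∂P := by
          refine setIntegral_mono_on (integrable_const _).integrableOn
            ((hpc.integrable_of_compactSpace P).const_mul _).integrableOn hAm fun y hy => ?_
          exact (hcmp N _ (Ξ N) (hΞ.monotone N) hy).2
      _ = Real.exp (N * (δ / 2)) * ∫ y in A, Real.exp (∑ j, f (y j)) ∂P := by
          rw [integral_const_mul, setIntegral_exp_sum_eq_permAverage ν f hAm
            (permCoord_mem_typicalSet (Ξ N) φ ε)]
      _ ≤ Real.exp (N * (δ / 2)) * ∫ y, Real.exp (∑ j, f (y j)) ∂P := by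
          refine mul_le_mul_of_nonneg_left ?_ (Real.exp_pos _).le
          exact setIntegral_le_integral (hec.integrable_of_compactSpace P)
            (ae_of_all _ fun y => (Real.exp_pos _).le)
      _ = _ := by rw [integral_exp_sum_pi]
  have hpos := permAverage_pos (Ξ N) f
  have h2 : permAverage (Ξ N) f ≤
      2 * (Real.exp (N * (δ / 2)) * (∫ x, Real.exp (f x) ∂(Measure.pi ν)) ^ N) := by
    nlinarith
  have h3 := Real.log_le_log hpos h2
  rw [Real.log_mul two_ne_zero (by positivity), Real.log_mul (Real.exp_pos _).ne' (by positivity),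
    Real.log_exp, Real.log_pow] at h3
  rw [mutualPressureTerm_eq, inv_mul_le_iff₀ hN0]
  linarith

/-- Tilting to `G` turns the integrand into `exp ∑ (f - g)`, which is at least `e^{N(m - δ/3)}` on a
set of `G`-samples of probability at least `1/2`. The matching marginals make these samples typical
for `Ξ`. -/
lemma eventually_le_mutualPressureTerm {R : ℝ} {n : ℕ} {Ξ : (N : ℕ) → Fin n → Fin N → Seg R}
    (ν : Fin n → Measure (Seg R)) [∀ i, IsProbabilityMeasure (ν i)] (hΞ : IsApproximating Ξ ν)
    {G : Measure (Cube R n)} [IsProbabilityMeasure G] (hGν : marginal G = ν)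
    {g : C(Cube R n, ℝ)}
    (hG : G = (Measure.pi ν).withDensity fun x => ENNReal.ofReal (Real.exp (g x)))
    (f : C(Cube R n, ℝ)) {δ : ℝ} (hδ : 0 < δ) :
    ∀ᶠ N in atTop, (∫ x, (f - g) x ∂G) - δ ≤ mutualPressureTerm (Ξ N) f := by
  have hδ3 : 0 < δ / 3 := by positivity
  obtain ⟨K, φ, ε, hε, hcmp⟩ := exists_permAverage_comparison f hδ3
  filter_upwards [eventually_half_le_typicalSet (Q := G) (hGν.symm ▸ hΞ) φ (f - g) hε hδ3,
    eventually_log_two_div_le hδ3] with N hN hN2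
  obtain ⟨hN0, hN2⟩ := hN2
  set P := Measure.pi fun _ : Fin N => Measure.pi ν with hP
  set A := typicalSet (Ξ N) φ ε
  set m := ∫ x, (f - g) x ∂G
  set B := {y : Fin N → Cube R n | |∑ j, (f - g) (y j) - N * m| ≤ N * (δ / 3)}
  have hAm : MeasurableSet A := measurableSet_typicalSet _ _ _
  have hBm : MeasurableSet B :=
    measurableSet_le (Continuous.measurable (by fun_prop)) measurable_const
  have hpc : Continuous fun y : Fin N → Cube R n => permAverage (fun i j => y j i) f := by
    unfold permAverage; fun_prop
  have hec : Continuous fun y : Fin N → Cube R n => Real.exp (∑ j, (f - g) (y j)) := by fun_prop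
  have hpos := permAverage_pos (Ξ N) f
  have h1 : Real.exp (N * (m - δ / 3)) * (1 / 2) ≤
      Real.exp (N * (δ / 3)) * permAverage (Ξ N) f := by
    calc Real.exp (N * (m - δ / 3)) * (1 / 2)
        ≤ Real.exp (N * (m - δ / 3)) * (Measure.pi fun _ : Fin N => G).real (A ∩ B) := by gcongr
      _ = ∫ y in A ∩ B, Real.exp (N * (m - δ / 3)) ∂(Measure.pi fun _ : Fin N => G) := by
          simp [mul_comm]
      _ ≤ ∫ y in A ∩ B, Real.exp (∑ j, (f - g) (y j)) ∂(Measure.pi fun _ : Fin N => G) := by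
          refine setIntegral_mono_on (integrable_const _).integrableOn
            (hec.integrable_of_compactSpace _).integrableOn (hAm.inter hBm) fun y hy => ?_
          rw [Real.exp_le_exp]
          have hyB : |∑ j, (f - g) (y j) - N * m| ≤ N * (δ / 3) := hy.2
          have := (abs_le.1 hyB).1
          linarith
      _ ≤ ∫ y in A, Real.exp (∑ j, (f - g) (y j)) ∂(Measure.pi fun _ : Fin N => G) :=
          setIntegral_mono_set (hec.integrable_of_compactSpace _).integrableOn
            (ae_of_all _ fun y => (Real.exp_pos _).le) Set.inter_subset_left.eventuallyLE
      _ = ∫ y in A, permAverage (fun i j => y j i) f ∂P := by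
          rw [setIntegral_exp_sum_tilt (Measure.pi ν) G f g hG hAm,
            setIntegral_exp_sum_eq_permAverage ν f hAm (permCoord_mem_typicalSet (Ξ N) φ ε)]
      _ ≤ ∫ y in A, Real.exp (N * (δ / 3)) * permAverage (Ξ N) f ∂P := by
          refine setIntegral_mono_on (hpc.integrable_of_compactSpace P).integrableOn
            (integrable_const _).integrableOn hAm fun y hy => ?_
          exact (hcmp N _ (Ξ N) (hΞ.monotone N) hy).1
      _ = P.real A * (Real.exp (N * (δ / 3)) * permAverage (Ξ N) f) := by simp
      _ ≤ 1 * (Real.exp (N * (δ / 3)) * permAverage (Ξ N) f) := by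
          gcongr
          exact measureReal_le_one
      _ = _ := one_mul _
  have h3 := Real.log_le_log (by positivity) h1
  rw [Real.log_mul (Real.exp_pos _).ne' (by positivity), Real.log_mul (Real.exp_pos _).ne' hpos.ne',
    Real.log_exp, Real.log_exp, one_div, Real.log_inv] at h3
  rw [mutualPressureTerm_eq, le_inv_mul_iff₀ hN0]
  linarith

/-! ### Passage to the limsup and shifts by one-coordinate sums -/

section Limsup

variable {R : ℝ} {n : ℕ} (Ξ : (N : ℕ) → Fin n → Fin N → Seg R) (f : C(Cube R n, ℝ))

lemma isBoundedUnder_le_mutualPressureTerm :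
    IsBoundedUnder (· ≤ ·) atTop fun N => mutualPressureTerm (Ξ N) f :=
  isBoundedUnder_of ⟨‖f‖, fun N => (abs_le.1 (abs_mutualPressureTerm_le (Ξ N) f)).2⟩

lemma isCoboundedUnder_le_mutualPressureTerm :
    IsCoboundedUnder (· ≤ ·) atTop fun N => mutualPressureTerm (Ξ N) f :=
  IsBoundedUnder.isCoboundedUnder_le
    (isBoundedUnder_of ⟨-‖f‖, fun N => (abs_le.1 (abs_mutualPressureTerm_le (Ξ N) f)).1⟩)

variable {Ξ f}

lemma mutualPressure_le_of_eventually {b : ℝ}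
    (h : ∀ δ > 0, ∀ᶠ N in atTop, mutualPressureTerm (Ξ N) f ≤ b + δ) :
    mutualPressure Ξ f ≤ b :=
  le_of_forall_pos_le_add fun δ hδ =>
    limsup_le_of_le (isCoboundedUnder_le_mutualPressureTerm Ξ f) (h δ hδ)

lemma le_mutualPressure_of_eventually {b : ℝ}
    (h : ∀ δ > 0, ∀ᶠ N in atTop, b - δ ≤ mutualPressureTerm (Ξ N) f) :
    b ≤ mutualPressure Ξ f :=
  le_of_forall_pos_le_add fun δ hδ => by
    have := le_limsup_of_frequently_le (h δ hδ).frequently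
      (isBoundedUnder_le_mutualPressureTerm Ξ f)
    rw [mutualPressure]
    linarith

end Limsup

/-- The sum of a constant and of functions of the single coordinates. -/
def separable {R : ℝ} {n : ℕ} (c : ℝ) (v : Fin n → C(Seg R, ℝ)) : C(Cube R n, ℝ) :=
  ⟨fun x => c + ∑ i, v i (x i), by fun_prop⟩

/-- A one-coordinate sum totals the same over `j` for every choice of permutations, so it factors
out. -/
lemma permAverage_add_separable_le {R : ℝ} {n N : ℕ} (ξ : Fin n → Fin N → Seg R)
    (f : C(Cube R n, ℝ)) (c : ℝ) (v : Fin n → C(Seg R, ℝ)) :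
    permAverage ξ (f + separable c v) ≤
      Real.exp (N * (c + ∑ i, mean fun j => v i (ξ i j))) * permAverage ξ f := by
  refine permAverage_le_exp_mul fun σ => le_of_eq ?_
  simp only [ContinuousMap.add_apply, Finset.sum_add_distrib]
  congr 1
  change ∑ j, (c + ∑ i, v i (ξ i ((σ i)⁻¹ j))) = _
  rw [Finset.sum_add_distrib, Finset.sum_comm, mul_add, Finset.mul_sum]
  simp only [natCast_mul_mean]
  congr 1
  · simp
  · exact Finset.sum_congr rfl fun i _ => Equiv.sum_comp (σ i)⁻¹ fun j => v i (ξ i j)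

lemma mutualPressure_add_separable_le {R : ℝ} {n : ℕ} {Ξ : (N : ℕ) → Fin n → Fin N → Seg R}
    (ν : Fin n → Measure (Seg R)) [∀ i, IsProbabilityMeasure (ν i)] (hΞ : IsApproximating Ξ ν)
    (f : C(Cube R n, ℝ)) (c : ℝ) (v : Fin n → C(Seg R, ℝ)) :
    mutualPressure Ξ (f + separable c v) ≤ mutualPressure Ξ f + (c + ∑ i, ∫ x, v i x ∂ν i) := by
  refine mutualPressure_le_of_eventually fun δ hδ => ?_
  have h1 := eventually_lt_of_limsup_lt (u := fun N => mutualPressureTerm (Ξ N) f)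
    (b := mutualPressure Ξ f + δ / 2) (by rw [← mutualPressure]; linarith)
    (isBoundedUnder_le_mutualPressureTerm Ξ f)
  have h2 : Tendsto (fun N => c + ∑ i, mean fun j => v i (Ξ N i j)) atTop
      (𝓝 (c + ∑ i, ∫ x, v i x ∂ν i)) :=
    (tendsto_finsetSum _ fun i _ => hΞ.tendsto_mean i (v i)).const_add c
  filter_upwards [h1, h2.eventually_lt_const (lt_add_of_pos_right _ (half_pos hδ)),
    eventually_gt_atTop 0] with N hN1 hN2 hN
  have hN0 : (0 : ℝ) < N := by exact_mod_cast hN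
  have h3 := Real.log_le_log (permAverage_pos _ _) (permAverage_add_separable_le (Ξ N) f c v)
  rw [Real.log_mul (Real.exp_pos _).ne' (permAverage_pos _ _).ne', Real.log_exp] at h3
  have h4 : mutualPressureTerm (Ξ N) (f + separable c v) ≤
      (c + ∑ i, mean fun j => v i (Ξ N i j)) + mutualPressureTerm (Ξ N) f := by
    rw [mutualPressureTerm_eq, mutualPressureTerm_eq, inv_mul_le_iff₀ hN0, mul_add,
      mul_inv_cancel_left₀ hN0.ne']
    exact h3
  linarith

lemma mutualPressure_add_separable {R : ℝ} {n : ℕ} {Ξ : (N : ℕ) → Fin n → Fin N → Seg R}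
    (ν : Fin n → Measure (Seg R)) [∀ i, IsProbabilityMeasure (ν i)] (hΞ : IsApproximating Ξ ν)
    (f : C(Cube R n, ℝ)) (c : ℝ) (v : Fin n → C(Seg R, ℝ)) :
    mutualPressure Ξ (f + separable c v) = mutualPressure Ξ f + (c + ∑ i, ∫ x, v i x ∂ν i) := by
  refine le_antisymm (mutualPressure_add_separable_le ν hΞ f c v) ?_
  -- The reverse inequality comes from undoing the shift.
  have h := mutualPressure_add_separable_le ν hΞ (f + separable c v) (-c) (fun i => -v i)
  have he : f + separable c v + separable (-c) (fun i => -v i) = f := by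
    ext x
    simp only [separable, ContinuousMap.add_apply, ContinuousMap.coe_mk, ContinuousMap.neg_apply,
      Finset.sum_neg_distrib]
    ring
  simp only [he, ContinuousMap.neg_apply, integral_neg, Finset.sum_neg_distrib] at h
  linarith

/-! ### Gibbs measures and their marginals -/

lemma gibbsMeasure_eq_tilted {X : Type*} [MeasureSpace X] (f : X → ℝ) :
    gibbsMeasure f = (volume : Measure X).tilted f := rfl

instance isFiniteMeasure_volume_seg (R : ℝ) : IsFiniteMeasure (volume : Measure (Seg R)) := by
  refine ⟨?_⟩
  rw [Measure.Subtype.volume_univ measurableSet_Icc.nullMeasurableSet]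
  exact measure_Icc_lt_top

lemma volume_seg_ne_zero {R : ℝ} (hR : 0 < R) : (volume : Measure (Seg R)) ≠ 0 := by
  rw [← Measure.measure_univ_ne_zero, Measure.Subtype.volume_univ measurableSet_Icc.nullMeasurableSet]
  simp
  linarith

lemma volume_pi_seg_ne_zero {R : ℝ} (hR : 0 < R) (ι : Type*) [Fintype ι] :
    (volume : Measure (ι → Seg R)) ≠ 0 := by
  rw [← Measure.measure_univ_ne_zero, volume_pi, Measure.pi_univ]
  exact Finset.prod_ne_zero_iff.2 fun i _ =>
    Measure.measure_univ_ne_zero.2 (volume_seg_ne_zero hR)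

section GibbsCompact

variable {X : Type*} [MeasureSpace X] [TopologicalSpace X] [CompactSpace X]
  [OpensMeasurableSpace X] (f : C(X, ℝ))

lemma integrable_exp_continuousMap (μ : Measure X) [IsFiniteMeasure μ] :
    Integrable (fun x => Real.exp (f x)) μ :=
  Continuous.integrable_of_compactSpace (by fun_prop) _

variable [IsFiniteMeasure (volume : Measure X)]

lemma isProbabilityMeasure_gibbsMeasure (h0 : (volume : Measure X) ≠ 0) :
    IsProbabilityMeasure (gibbsMeasure f) := by
  have : NeZero (volume : Measure X) := ⟨h0⟩
  rw [gibbsMeasure_eq_tilted]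
  exact isProbabilityMeasure_tilted (integrable_exp_continuousMap f _)

lemma gibbsMeasure_eq_withDensity_exp (h0 : (volume : Measure X) ≠ 0) :
    gibbsMeasure f = (volume : Measure X).withDensity fun x =>
      ENNReal.ofReal (Real.exp (f x - Real.log (∫ y, Real.exp (f y)))) := by
  have : NeZero (volume : Measure X) := ⟨h0⟩
  simp only [gibbsMeasure, Real.exp_sub,
    Real.exp_log (integral_exp_pos (integrable_exp_continuousMap f volume))]

end GibbsCompact

lemma continuous_insertCoord {R : ℝ} {n : ℕ} (i : Fin n) :
    Continuous fun p : Seg R × ({j : Fin n // j ≠ i} → Seg R) => insertCoord i p.1 p.2 := by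
  refine continuous_pi fun j => ?_
  by_cases hj : j = i
  · simp only [insertCoord, hj, dite_true]
    exact continuous_fst
  · simp only [insertCoord, hj, dite_false]
    fun_prop

lemma measurePreserving_insertCoord {R : ℝ} {n : ℕ} (i : Fin n) :
    MeasurePreserving (fun p : Seg R × ({j : Fin n // j ≠ i} → Seg R) => insertCoord i p.1 p.2)
      ((volume : Measure (Seg R)).prod volume) volume := by
  have hm : Measurable fun p : Seg R × ({j : Fin n // j ≠ i} → Seg R) =>
      insertCoord i p.1 p.2 := (continuous_insertCoord i).measurable
  refine ⟨hm, (Measure.pi_eq fun s hs => ?_).symm⟩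
  have hpre : (fun p : Seg R × ({j : Fin n // j ≠ i} → Seg R) => insertCoord i p.1 p.2) ⁻¹'
      Set.univ.pi s = s i ×ˢ Set.univ.pi fun j : {j : Fin n // j ≠ i} => s j := by
    ext p
    simp only [Set.mem_preimage, Set.mem_pi, Set.mem_univ, true_imp_iff, Set.mem_prod]
    constructor
    · intro hp
      refine ⟨by simpa [insertCoord] using hp i, fun j => ?_⟩
      simpa [insertCoord, j.2] using hp j
    · rintro ⟨h1, h2⟩ j
      by_cases hj : j = i
      · subst hj; simpa [insertCoord] using h1
      · simpa [insertCoord, hj] using h2 ⟨j, hj⟩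
  rw [Measure.map_apply hm (MeasurableSet.univ_pi hs), hpre, Measure.prod_prod, volume_pi,
    Measure.pi_pi, Fintype.prod_eq_mul_prod_subtype_ne _ i]

section MarginalPotential

variable {R : ℝ} {n : ℕ} (h : C(Cube R n, ℝ)) (i : Fin n)

lemma continuous_exp_insertCoord :
    Continuous fun p : Seg R × ({j : Fin n // j ≠ i} → Seg R) =>
      Real.exp (h (insertCoord i p.1 p.2)) :=
  Real.continuous_exp.comp (h.continuous.comp (continuous_insertCoord i))

lemma integral_exp_insertCoord_pos (hR : 0 < R) (x : Seg R) :
    0 < ∫ y : {j : Fin n // j ≠ i} → Seg R, Real.exp (h (insertCoord i x y)) := by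
  have : NeZero (volume : Measure ({j : Fin n // j ≠ i} → Seg R)) :=
    ⟨volume_pi_seg_ne_zero hR _⟩
  exact integral_exp_pos (Continuous.integrable_of_compactSpace
    ((continuous_exp_insertCoord h i).comp (Continuous.prodMk_right x)) _)

lemma exp_marginalPotential (hR : 0 < R) (x : Seg R) :
    Real.exp (marginalPotential h i x) =
      ∫ y : {j : Fin n // j ≠ i} → Seg R, Real.exp (h (insertCoord i x y)) :=
  Real.exp_log (integral_exp_insertCoord_pos h i hR x)

lemma continuous_marginalPotential (hR : 0 < R) : Continuous (marginalPotential h i) := by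
  refine Continuous.log ?_ fun x => (integral_exp_insertCoord_pos h i hR x).ne'
  have := continuous_parametric_integral_of_continuous
    (μ := (volume : Measure ({j : Fin n // j ≠ i} → Seg R)))
    (f := fun x y => Real.exp (h (insertCoord i x y)))
    (continuous_exp_insertCoord h i) isCompact_univ
  simpa only [Measure.restrict_univ] using this

lemma integral_exp_marginalPotential (hR : 0 < R) :
    ∫ x, Real.exp (marginalPotential h i x) = ∫ x, Real.exp (h x) := by
  simp only [exp_marginalPotential h i hR]
  rw [← integral_prod (f := fun p : Seg R × ({j : Fin n // j ≠ i} → Seg R) =>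
      Real.exp (h (insertCoord i p.1 p.2)))
    ((continuous_exp_insertCoord h i).integrable_of_compactSpace _)]
  have hP := measurePreserving_insertCoord (R := R) i
  rw [← hP.map_eq, integral_map hP.aemeasurable
    (Continuous.aestronglyMeasurable (by fun_prop))]

/-- The marginals of the Gibbs measure of `h` are the Gibbs measures of its marginal potentials. -/
lemma marginal_gibbsMeasure (hR : 0 < R) :
    marginal (gibbsMeasure h) i = gibbsMeasure (marginalPotential h i) := by
  ext s hs
  have hev : Measurable fun x : Cube R n => x i := measurable_pi_apply i
  have hP := measurePreserving_insertCoord (R := R) i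
  have hZ : 0 ≤ ∫ x, Real.exp (h x) := integral_nonneg fun x => (Real.exp_pos _).le
  rw [marginal, Measure.map_apply hev hs, gibbsMeasure, gibbsMeasure,
    withDensity_apply _ (hev hs), withDensity_apply _ hs, integral_exp_marginalPotential h i hR,
    ← hP.setLIntegral_comp_preimage (hev hs) (by fun_prop)]
  have hpre : (fun p : Seg R × ({j : Fin n // j ≠ i} → Seg R) => insertCoord i p.1 p.2) ⁻¹'
      ((fun x : Cube R n => x i) ⁻¹' s) = s ×ˢ Set.univ := by
    ext p; simp [insertCoord]
  have hmeas : Measurable fun p : Seg R × ({j : Fin n // j ≠ i} → Seg R) =>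
      ENNReal.ofReal (Real.exp (h (insertCoord i p.1 p.2)) / ∫ x, Real.exp (h x)) :=
    ((continuous_exp_insertCoord h i).measurable.div_const _).ennreal_ofReal
  rw [hpre, setLIntegral_prod _ hmeas.aemeasurable]
  refine lintegral_congr fun x => ?_
  have hx : Continuous fun y : {j : Fin n // j ≠ i} → Seg R =>
      Real.exp (h (insertCoord i x y)) :=
    (continuous_exp_insertCoord h i).comp (Continuous.prodMk_right x)
  rw [exp_marginalPotential h i hR, ← integral_div, Measure.restrict_univ,
    ofReal_integral_eq_lintegral_ofReal ((hx.integrable_of_compactSpace _).div_const _)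
      (ae_of_all _ fun y => div_nonneg (Real.exp_pos _).le hZ)]

end MarginalPotential

/-- The Gibbs measure of `h` has density `exp (h - a)` with respect to the product of its
marginals, where `a` is a sum of functions of the single coordinates. -/
lemma exists_gibbsMeasure_eq_withDensity_pi {R : ℝ} (hR : 0 < R) {n : ℕ} (h : C(Cube R n, ℝ)) :
    ∃ (c : ℝ) (v : Fin n → C(Seg R, ℝ)), gibbsMeasure h =
      (Measure.pi fun i => gibbsMeasure (marginalPotential h i)).withDensity
        fun x => ENNReal.ofReal (Real.exp ((h - separable c v) x)) := by
  let w : Fin n → C(Seg R, ℝ) := fun i => ⟨_, continuous_marginalPotential h i hR⟩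
  -- Normalised so that `exp (v i)` is the density of the `i`-th marginal.
  let v : Fin n → C(Seg R, ℝ) := fun i =>
    w i - ContinuousMap.const _ (Real.log (∫ y, Real.exp (w i y)))
  refine ⟨Real.log (∫ y, Real.exp (h y)), v, ?_⟩
  have hν : ∀ i, gibbsMeasure (marginalPotential h i) =
      (volume : Measure (Seg R)).withDensity fun x => ENNReal.ofReal (Real.exp (v i x)) :=
    fun i => gibbsMeasure_eq_withDensity_exp (w i) (volume_seg_ne_zero hR)
  simp only [hν]
  rw [pi_withDensity_exp (fun _ => (volume : Measure (Seg R))) (fun i => v i)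
      (fun i => integrable_exp_continuousMap (v i) _), ← volume_pi,
    ← withDensity_mul _ (by fun_prop) (by fun_prop),
    gibbsMeasure_eq_withDensity_exp h (volume_pi_seg_ne_zero hR _)]
  congr 1
  ext x
  rw [Pi.mul_apply, ← ENNReal.ofReal_mul (Real.exp_pos _).le, ← Real.exp_add]
  congr 2
  simp only [separable, ContinuousMap.sub_apply, ContinuousMap.coe_mk]
  ring

/-! ### Equilibrium and identification of the measure -/

/-- The right side vanishes at `t = 0` with derivative `∫ u dG`, so a line through the origin below
it has that slope. -/
lemma integral_eq_of_mul_le_log_integral_exp {X : Type*} [TopologicalSpace X] [CompactSpace X]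
    [MeasurableSpace X] [OpensMeasurableSpace X] {μ G : Measure X} [IsProbabilityMeasure G]
    (u : C(X, ℝ))
    (h : ∀ t : ℝ, t * ∫ x, u x ∂μ ≤ Real.log (∫ x, Real.exp (t * u x) ∂G)) :
    ∫ x, u x ∂μ = ∫ x, u x ∂G := by
  set C := ‖u‖ ^ 2
  -- Quantitative form of the derivative, from `e^s ≤ 1 + s + s²` for `|s| ≤ 1` and `log z ≤ z - 1`.
  have hquad : ∀ t : ℝ, |t| * ‖u‖ ≤ 1 →
      t * ∫ x, u x ∂μ ≤ t * ∫ x, u x ∂G + t ^ 2 * C := by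
    intro t ht
    have hexp : Integrable (fun x => Real.exp (t * u x)) G :=
      Continuous.integrable_of_compactSpace (by fun_prop) _
    have hui : Integrable (fun x => t * u x) G := (u.integrable_of_compactSpace G).const_mul t
    have hui1 : Integrable (fun x => 1 + t * u x) G := (integrable_const _).add hui
    have hpt : ∀ x, Real.exp (t * u x) ≤ 1 + t * u x + t ^ 2 * C := by
      intro x
      have hu : |u x| ≤ ‖u‖ := u.norm_coe_le_norm x
      have h1 : |t * u x| ≤ 1 := by
        rw [abs_mul]
        exact (mul_le_mul_of_nonneg_left hu (abs_nonneg t)).trans ht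
      have h2 := (abs_le.1 (Real.abs_exp_sub_one_sub_id_le h1)).2
      have h3 : (t * u x) ^ 2 ≤ t ^ 2 * C := by
        rw [mul_pow]
        refine mul_le_mul_of_nonneg_left ?_ (sq_nonneg t)
        exact sq_le_sq' (abs_le.1 hu).1 (abs_le.1 hu).2
      linarith
    have hint : ∫ x, Real.exp (t * u x) ∂G ≤ 1 + t * ∫ x, u x ∂G + t ^ 2 * C := by
      calc ∫ x, Real.exp (t * u x) ∂G ≤ ∫ x, (1 + t * u x + t ^ 2 * C) ∂G :=
            integral_mono hexp (hui1.add (integrable_const _)) hpt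
        _ = _ := by
            rw [integral_add hui1 (integrable_const _),
              integral_add (integrable_const _) hui, integral_const_mul]
            simp
    have hlog := Real.log_le_sub_one_of_pos (integral_exp_pos hexp)
    linarith [h t]
  have hle : ∀ s : ℝ, (s = 1 ∨ s = -1) → s * (∫ x, u x ∂μ - ∫ x, u x ∂G) ≤ 0 := by
    intro s hs
    have hs2 : s ^ 2 = 1 := by rcases hs with rfl | rfl <;> norm_num
    have hsa : |s| = 1 := by rcases hs with rfl | rfl <;> norm_num
    refine le_of_forall_pos_le_add fun ε hε => ?_
    -- Small enough for `hquad` and for an error at most `ε` after division by `r`.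
    set r := min (1 / (‖u‖ + 1)) (ε / (C + 1)) with hr
    have hC : 0 ≤ C := sq_nonneg _
    have hr0 : 0 < r := lt_min (by positivity) (by positivity)
    have hr1 : r * ‖u‖ ≤ 1 := by
      have : r * (‖u‖ + 1) ≤ 1 := by
        rw [← le_div_iff₀ (by positivity)]; exact min_le_left _ _
      nlinarith
    have hr2 : r * C ≤ ε := by
      have : r * (C + 1) ≤ ε := by
        rw [← le_div_iff₀ (by positivity)]; exact min_le_right _ _
      nlinarith
    have h1 := hquad (r * s) (by rwa [abs_mul, abs_of_pos hr0, hsa, mul_one])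
    have h2 : r * (s * (∫ x, u x ∂μ - ∫ x, u x ∂G)) ≤ r * (r * C) := by
      have : (r * s) ^ 2 = r ^ 2 := by rw [mul_pow, hs2, mul_one]
      rw [this] at h1
      nlinarith
    linarith [le_of_mul_le_mul_left h2 hr0]
  linarith [hle 1 (Or.inl rfl), hle (-1) (Or.inr rfl)]

lemma isMutuallyEquilibrium_iff {R : ℝ} {n : ℕ} {Ξ : (N : ℕ) → Fin n → Fin N → Seg R}
    {μ : Measure (Cube R n)} {h : C(Cube R n, ℝ)} :
    IsMutuallyEquilibrium Ξ μ h ↔ ∀ f : C(Cube R n, ℝ),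
      (∫ x, f x ∂μ) - mutualPressure Ξ f ≤ (∫ x, h x ∂μ) - mutualPressure Ξ h := by
  unfold IsMutuallyEquilibrium mutualInfo
  constructor
  · intro he f
    rw [← EReal.coe_le_coe_iff, ← he]
    exact le_iSup (fun f : C(Cube R n, ℝ) =>
      (((∫ x, f x ∂μ) - mutualPressure Ξ f : ℝ) : EReal)) f
  · intro hf
    refine le_antisymm (iSup_le fun f => EReal.coe_le_coe_iff.2 (hf f)) ?_
    exact le_iSup (fun f : C(Cube R n, ℝ) =>
      (((∫ x, f x ∂μ) - mutualPressure Ξ f : ℝ) : EReal)) h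



lemma isProbabilityMeasure_marginal {R : ℝ} {n : ℕ} (Q : Measure (Cube R n))
    [IsProbabilityMeasure Q] (i : Fin n) : IsProbabilityMeasure (marginal Q i) :=
  Measure.isProbabilityMeasure_map (measurable_pi_apply i).aemeasurable

lemma integral_separable {R : ℝ} {n : ℕ} (Q : Measure (Cube R n)) [IsProbabilityMeasure Q]
    (c : ℝ) (v : Fin n → C(Seg R, ℝ)) :
    ∫ x, separable c v x ∂Q = c + ∑ i, ∫ x, v i x ∂(marginal Q i) := by
  have hi : ∀ i, Integrable (fun x : Cube R n => v i (x i)) Q := fun i =>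
    Continuous.integrable_of_compactSpace (by fun_prop) _
  have hm : ∀ i, ∫ x, v i x ∂(marginal Q i) = ∫ x, v i (x i) ∂Q := fun i =>
    integral_map (measurable_pi_apply i).aemeasurable (v i).continuous.aestronglyMeasurable
  simp only [hm, separable, ContinuousMap.coe_mk]
  rw [integral_add (integrable_const _) (integrable_finsetSum _ fun i _ => hi i),
    integral_finsetSum _ fun i _ => hi i]
  simp

/-- The density `e^g` turns the upper bound over `⊗ν` into an integral against `G`; for a
probability measure `G` it is `0` at `t = 0`. -/
lemma mutualPressure_add_smul_le {R : ℝ} {n : ℕ} {Ξ : (N : ℕ) → Fin n → Fin N → Seg R}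
    (ν : Fin n → Measure (Seg R)) [∀ i, IsProbabilityMeasure (ν i)] (hΞ : IsApproximating Ξ ν)
    {G : Measure (Cube R n)} {g : C(Cube R n, ℝ)}
    (hG : G = (Measure.pi ν).withDensity fun x => ENNReal.ofReal (Real.exp (g x)))
    (u : C(Cube R n, ℝ)) (t : ℝ) :
    mutualPressure Ξ (g + t • u) ≤ Real.log (∫ x, Real.exp (t * u x) ∂G) := by
  have hI : ∫ x, Real.exp (t * u x) ∂G = ∫ x, Real.exp ((g + t • u) x) ∂(Measure.pi ν) := by
    rw [hG, integral_withDensity_eq_integral_toReal_smul (by fun_prop)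
      (ae_of_all _ fun _ => ENNReal.ofReal_lt_top)]
    refine integral_congr_ae (ae_of_all _ fun x => ?_)
    simp [ENNReal.toReal_ofReal (Real.exp_pos _).le, Real.exp_add]
  rw [hI]
  exact mutualPressure_le_of_eventually fun δ hδ =>
    eventually_mutualPressureTerm_le ν hΞ (g + t • u) hδ

end MutualPressure

end

/-! ### The equivalence -/

open MutualPressure MeasureTheory in
theorem proposition3p6 (R : ℝ) (hR : 0 < R) (n : ℕ)
    (h : C(MutualPressure.Cube R n, ℝ))
    (μ : MeasureTheory.Measure (MutualPressure.Cube R n))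
    (hμ : MeasureTheory.IsProbabilityMeasure μ)
    (Ξ : (N : ℕ) → Fin n → Fin N → MutualPressure.Seg R)
    (hΞ : MutualPressure.IsApproximating Ξ (MutualPressure.marginal μ)) :
    μ = MutualPressure.gibbsMeasure h ↔
      MutualPressure.IsMutuallyEquilibrium Ξ μ h ∧
        ∀ i : Fin n, MutualPressure.marginal μ i =
          MutualPressure.gibbsMeasure (MutualPressure.marginalPotential h i) := by
  obtain ⟨c, v, hG⟩ := exists_gibbsMeasure_eq_withDensity_pi hR h
  set G := gibbsMeasure h with hGdef
  set g := h - separable c v with hg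
  have hGp : IsProbabilityMeasure G :=
    isProbabilityMeasure_gibbsMeasure h (volume_pi_seg_ne_zero hR _)
  have hGm : ∀ i, marginal G i = gibbsMeasure (marginalPotential h i) :=
    fun i => marginal_gibbsMeasure h i hR
  have hGν : marginal G = fun i => gibbsMeasure (marginalPotential h i) := funext hGm
  rw [← hGν] at hG
  have hGprob := isProbabilityMeasure_marginal G
  have hgs : g + separable c v = h := sub_add_cancel h _
  constructor
  · rintro rfl
    refine ⟨isMutuallyEquilibrium_iff.2 fun f => ?_, hGm⟩
    have hlow : ∫ x, (f - g) x ∂G ≤ mutualPressure Ξ f :=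
      le_mutualPressure_of_eventually fun δ hδ =>
        eventually_le_mutualPressureTerm (marginal G) hΞ rfl hG f hδ
    have hup : mutualPressure Ξ g ≤ 0 := by
      simpa using mutualPressure_add_smul_le (marginal G) hΞ hG 0 0
    have hshift := mutualPressure_add_separable (marginal G) hΞ g c v
    rw [hgs, ← integral_separable G] at hshift
    have hfg : ∫ x, (f - g) x ∂G = ∫ x, f x ∂G - ∫ x, g x ∂G :=
      integral_sub (f.integrable_of_compactSpace G) (g.integrable_of_compactSpace G)
    have hgG : ∫ x, g x ∂G = ∫ x, h x ∂G - ∫ x, separable c v x ∂G :=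
      integral_sub (h.integrable_of_compactSpace G) ((separable c v).integrable_of_compactSpace G)
    linarith
  · rintro ⟨heq, hm⟩
    have hμG : marginal μ = marginal G := by rw [hGν]; exact funext hm
    rw [hμG] at hΞ
    -- The lower bound at `f = g`, where `f - g = 0`.
    have hlow : 0 ≤ mutualPressure Ξ g :=
      le_mutualPressure_of_eventually fun δ hδ => by
        simpa using eventually_le_mutualPressureTerm (marginal G) hΞ rfl hG g hδ
    refine ext_of_forall_integral_eq_of_IsFiniteMeasure fun u => ?_
    refine integral_eq_of_mul_le_log_integral_exp u.toContinuousMap fun t => ?_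
    -- Perturb the maximiser `h` by `t u`; the shift constants of `h` and `h + t u` agree and
    -- cancel.
    have h1 := isMutuallyEquilibrium_iff.1 heq (h + t • u.toContinuousMap)
    have h2 := mutualPressure_add_smul_le (marginal G) hΞ hG u.toContinuousMap t
    have h3 := mutualPressure_add_separable (marginal G) hΞ g c v
    have h4 := mutualPressure_add_separable (marginal G) hΞ (g + t • u.toContinuousMap) c v
    rw [hgs] at h3
    rw [add_right_comm, hgs] at h4
    have h5 : ∫ x, (h + t • u.toContinuousMap) x ∂μ =
        ∫ x, h x ∂μ + t * ∫ x, u.toContinuousMap x ∂μ := by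
      rw [← integral_const_mul]
      exact integral_add (h.integrable_of_compactSpace μ)
        ((u.toContinuousMap.integrable_of_compactSpace μ).const_mul t)
    linarith
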